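/- All Banach spaces are real. For a metric space $\mathcal M$ with base point $0$, let $\mathrm{Lip}_0(\mathcal M)$ be the Banach space of Lipschitz functions $f:\mathcal M\to\mathbb R$ with $f(0)=0$, normed by the minimal Lipschitz constant, and let $\mathcal F(\mathcal M)=\overline{\mathrm{span}}\{\delta(x):x\in\mathcal M\}\subset \mathrm{Lip}_0(\mathcal M)^*$, $\delta(x)(f)=f(x)$, so that $\mathcal F(\mathcal M)^*=\mathrm{Lip}_0(\mathcal M)$. For $A\subset \mathrm{Lip}_0(\mathcal M)$ put $A_\perp=\{\mu\in\mathcal F(\mathcal M):\langle f,\mu\rangle=0\ \forall f\in A\}$. Let $G$ be a Hausdorff topological group that acts continuously and by isometries on $\mathcal M$, with bounded orbits. Assume that $G$ is amenable, and that $G$ is locally compact or SIN (every neighbourhood of the identity contains a neighbourhood $V$ of the identity with $gVg^{-1}=V$ for all $g\in G$). Let $M$ be a bi-invariant mean on $G$: a positive linear functional with $M(1)=1$, invariant under left and right shifts, defined on $L_\infty(G)$ if $G$ is locally compact, and, if $G$ is SIN, on the space of bounded functions on $G$ that are both left and right uniformly continuous. (If $G$ is both, either domain is allowed.) For $g\in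 G$ let $T_g$ be the linear isometry of $\mathcal F(\mathcal M)$ with $T_g\delta(x)=\delta(gx)-\delta(g0)$ for $x\in\mathcal M$, and let $R_G:\mathcal F(\mathcal M)\to\mathcal F(\mathcal M)^{**}$ be given by $R_G(\mu)(\varphi)=M\big(g\mapsto\varphi(T_g\mu)\big)$. Suppose that $\mathcal F(\mathcal M)$ is complemented in its bidual by a bounded linear projection $Q:\mathcal F(\mathcal M)^{**}\to\mathcal F(\mathcal M)$ with $T_g^{**}(\ker Q)\subset\ker Q$ for all $g\in G$, and put $P_G=Q\circ R_G:\mathcal F(\mathcal M)\to\mathcal F(\mathcal M)$. Let $\mathcal M/G$ be the set of closures of orbits $[Gx]=\overline{Gx}$, $x\in\mathcal M$, with the metric $d([Gx],[Gy])=\inf\{d(x',y'):x'\in[Gx],\,y'\in[Gy]\}$ and base point $[G0]$. Let $\mathrm{Lip}_0^G(\mathcal M)$ be the space of $G$-invariant functions in $\mathrm{Lip}_0(\mathcal M)$, and $\Psi:\mathrm{Lip}_0(\mathcal M/G)\to\mathrm{Lip}_0^G(\mathcal M)$ the map $\Psi(f)(x)=f([Gx])$. **Theorem.** If some set $Y\subset\mathrm{Lip}_0(\mathcal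 M/G)$ separates the points of $\mathcal F(\mathcal M/G)$ and $\ker P_G\subset\Psi(Y)_\perp$, then $\ker P_G=\mathrm{Lip}_0^G(\mathcal M)_\perp$, and $P_G[\mathcal F(\mathcal M)]$ is $\|Q\|$-isomorphic to $\mathcal F(\mathcal M/G)$, that is, there is a linear isomorphism $T$ of $\mathcal F(\mathcal M/G)$ onto $P_G[\mathcal F(\mathcal M)]$ with $\|T\|\,\|T^{-1}\|\le\|Q\|$. In particular $P_G[\mathcal F(\mathcal M)]$ is a complemented subspace of $\mathcal F(\mathcal M)$, so $\mathcal F(\mathcal M/G)$ is isomorphic to a complemented subspace of $\mathcal F(\mathcal M)$. -/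

import Mathlib

open MeasureTheory Topology
open scoped ENNReal NNReal

set_option maxSynthPendingDepth 3

noncomputable section

/-! ## Lipschitz functions vanishing at the base point, and the Lipschitz-free space -/

/-- Real-valued Lipschitz functions on `M` that vanish at the base point `o`. -/
def lip0Submodule (M : Type*) [MetricSpace M] (o : M) : Submodule ℝ (M → ℝ) where
  carrier := {f | f o = 0 ∧ ∃ K : ℝ≥0, LipschitzWith K f}
  zero_mem' := ⟨rfl, 0, LipschitzWith.const 0⟩
  add_mem' := by
    rintro f g ⟨hf, K, hK⟩ ⟨hg, L, hL⟩
    exact ⟨by simp [hf, hg], K + L, hK.add hL⟩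
  smul_mem' := by
    rintro c f ⟨hf, K, hK⟩
    refine ⟨by simp [hf], ‖c‖₊ * K, LipschitzWith.of_dist_le_mul fun x y => ?_⟩
    have h := hK.dist_le_mul x y
    simp only [Pi.smul_apply, smul_eq_mul, Real.dist_eq, ← mul_sub, abs_mul] at h ⊢
    rw [NNReal.coe_mul, coe_nnnorm, Real.norm_eq_abs, mul_assoc]
    exact mul_le_mul_of_nonneg_left h (abs_nonneg c)

/-- The space `Lip₀(M)`; it carries the norm given by the minimal Lipschitz constant. -/
def Lip0 (M : Type*) [MetricSpace M] (o : M) : Type _ := lip0Submodule M o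

namespace Lip0

variable {M : Type*} [MetricSpace M] {o : M}

instance : AddCommGroup (Lip0 M o) := inferInstanceAs (AddCommGroup (lip0Submodule M o))

instance : Module ℝ (Lip0 M o) := inferInstanceAs (Module ℝ (lip0Submodule M o))

instance : CoeFun (Lip0 M o) fun _ => M → ℝ := ⟨fun f => f.1⟩

@[ext] theorem ext {f g : Lip0 M o} (h : ∀ x, f x = g x) : f = g := Subtype.ext (funext h)

@[simp] theorem add_apply (f g : Lip0 M o) (x : M) : (f + g) x = f x + g x := rfl
@[simp] theorem neg_apply (f : Lip0 M o) (x : M) : (-f) x = -f x := rfl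
@[simp] theorem smul_apply (c : ℝ) (f : Lip0 M o) (x : M) : (c • f) x = c * f x := rfl
@[simp] theorem zero_apply (x : M) : (0 : Lip0 M o) x = 0 := rfl
@[simp] theorem base_apply (f : Lip0 M o) : f o = 0 := f.2.1

/-- Build an element of `Lip₀(M)` from a function with a Lipschitz bound. -/
def mk' (f : M → ℝ) (h0 : f o = 0) (K : ℝ) (hK : 0 ≤ K)
    (h : ∀ x y, |f x - f y| ≤ K * dist x y) : Lip0 M o :=
  ⟨f, h0, ⟨K, hK⟩, LipschitzWith.of_dist_le_mul fun x y => by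
    rw [Real.dist_eq]; exact h x y⟩

/-- The minimal Lipschitz constant of `f`. -/
def lipNorm (f : Lip0 M o) : ℝ :=
  sInf {K : ℝ | 0 ≤ K ∧ ∀ x y, |f x - f y| ≤ K * dist x y}

theorem lipNorm_nonneg (f : Lip0 M o) : 0 ≤ lipNorm f := Real.sInf_nonneg fun _ h => h.1

theorem abs_sub_le_lipNorm (f : Lip0 M o) (x y : M) :
    |f x - f y| ≤ lipNorm f * dist x y := by
  obtain ⟨K, hK⟩ := f.2.2
  have hne : {K : ℝ | 0 ≤ K ∧ ∀ x y, |f x - f y| ≤ K * dist x y}.Nonempty :=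
    ⟨K, K.2, fun x y => by have := hK.dist_le_mul x y; rwa [Real.dist_eq] at this⟩
  rcases eq_or_ne x y with rfl | hxy
  · simp
  · have hd : 0 < dist x y := dist_pos.2 hxy
    rw [← div_le_iff₀ hd]
    exact le_csInf hne fun L hL => (div_le_iff₀ hd).2 (hL.2 x y)

theorem lipNorm_le (f : Lip0 M o) {K : ℝ} (hK : 0 ≤ K)
    (h : ∀ x y, |f x - f y| ≤ K * dist x y) : lipNorm f ≤ K :=
  csInf_le ⟨0, fun _ h => h.1⟩ ⟨hK, h⟩

instance : NormedAddCommGroup (Lip0 M o) :=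
  AddGroupNorm.toNormedAddCommGroup
    { toFun := lipNorm
      map_zero' := le_antisymm (lipNorm_le _ le_rfl fun x y => by simp) (lipNorm_nonneg _)
      add_le' := fun f g => lipNorm_le _ (add_nonneg (lipNorm_nonneg f) (lipNorm_nonneg g))
        fun x y => by
          have h1 := abs_sub_le_lipNorm f x y
          have h2 := abs_sub_le_lipNorm g x y
          have h3 := abs_add_le (f x - f y) (g x - g y)
          have h4 : (f + g) x - (f + g) y = (f x - f y) + (g x - g y) := by
            simp only [add_apply]; ring
          rw [h4, add_mul]; linarith
      neg' := fun f => by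
        have key : ∀ x y, |(-f) x - (-f) y| = |f x - f y| := fun x y => by
          rw [← abs_neg]; simp only [neg_apply]; congr 1; ring
        simp only [lipNorm, key]
      eq_zero_of_map_eq_zero' := fun f hf => by
        ext x
        have h := abs_sub_le_lipNorm f x o
        rw [hf, zero_mul, base_apply, sub_zero] at h
        exact abs_eq_zero.1 (le_antisymm h (abs_nonneg _)) }

theorem norm_def (f : Lip0 M o) :
    ‖f‖ = sInf {K : ℝ | 0 ≤ K ∧ ∀ x y, |f x - f y| ≤ K * dist x y} := rfl

theorem abs_sub_le (f : Lip0 M o) (x y : M) : |f x - f y| ≤ ‖f‖ * dist x y :=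
  abs_sub_le_lipNorm f x y

theorem norm_le (f : Lip0 M o) {K : ℝ} (hK : 0 ≤ K)
    (h : ∀ x y, |f x - f y| ≤ K * dist x y) : ‖f‖ ≤ K := lipNorm_le f hK h

instance : NormedSpace ℝ (Lip0 M o) where
  norm_smul_le c f := norm_le _ (by positivity) fun x y => by
    rw [smul_apply, smul_apply, ← mul_sub, abs_mul, Real.norm_eq_abs, mul_assoc]
    exact mul_le_mul_of_nonneg_left (abs_sub_le f x y) (abs_nonneg c)

/-- The evaluation functional `δ(m) ∈ Lip₀(M)*`. -/
def delta (o m : M) : StrongDual ℝ (Lip0 M o) :=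
  LinearMap.mkContinuous
    { toFun := fun f => f m
      map_add' := fun _ _ => rfl
      map_smul' := fun _ _ => rfl } (dist m o) fun f => by
    have h := abs_sub_le f m o
    rw [base_apply, sub_zero] at h
    rw [Real.norm_eq_abs, mul_comm]
    exact h

@[simp] theorem delta_apply (m : M) (f : Lip0 M o) : delta o m f = f m := rfl

theorem norm_delta_sub_le (m n : M) : ‖delta o m - delta o n‖ ≤ dist m n :=
  ContinuousLinearMap.opNorm_le_bound _ dist_nonneg fun f => by
    rw [mul_comm]; exact abs_sub_le f m n

end Lip0

/-- The Lipschitz-free space `F(M)`: the closed linear span of the evaluation functionals `δ(m)`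
in the dual of `Lip₀(M)`, with the dual norm. For `μ : LipFree M o` and `f : Lip0 M o`, the
duality pairing `⟨f, μ⟩` is `μ.1 f`. -/
def LipFree (M : Type*) [MetricSpace M] (o : M) : Type _ :=
  (Submodule.span ℝ (Set.range (Lip0.delta o))).topologicalClosure

instance {M : Type*} [MetricSpace M] {o : M} : NormedAddCommGroup (LipFree M o) :=
  inferInstanceAs (NormedAddCommGroup
    (Submodule.span ℝ (Set.range (Lip0.delta o))).topologicalClosure)

instance {M : Type*} [MetricSpace M] {o : M} : NormedSpace ℝ (LipFree M o) :=
  inferInstanceAs (NormedSpace ℝ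
    (Submodule.span ℝ (Set.range (Lip0.delta o))).topologicalClosure)

theorem LipFree.norm_def {M : Type*} [MetricSpace M] {o : M} (μ : LipFree M o) :
    ‖μ‖ = ‖μ.1‖ := rfl

/-- The set `A_⊥` of all `μ ∈ F(M)` annihilated by every `f ∈ A ⊂ Lip₀(M) = F(M)*`. -/
def preannihilator {M : Type*} [MetricSpace M] {o : M} (A : Set (Lip0 M o)) :
    Submodule ℝ (LipFree M o) where
  carrier := {μ | ∀ f ∈ A, μ.1 f = 0}
  zero_mem' := fun f _ => rfl
  add_mem' := fun {μ ν} hμ hν f hf => by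
    change μ.1 f + ν.1 f = 0
    rw [hμ f hf, hν f hf, add_zero]
  smul_mem' := fun c μ hμ f hf => by
    change c * μ.1 f = 0
    rw [hμ f hf, mul_zero]

/-! ## The linear action `T` of `G` on `F(M)` -/

section Action

variable {G M : Type*} [Group G] [MetricSpace M] [MulAction G M] [IsIsometricSMul G M] {o : M}

/-- The operator `f ↦ (m ↦ f (g m) - f (g o))` on `Lip₀(M)`. -/
def lipShift (o : M) (g : G) : Lip0 M o →L[ℝ] Lip0 M o :=
  LinearMap.mkContinuous
    { toFun := fun f => Lip0.mk' (fun m => f (g • m) - f (g • o)) (sub_self _) ‖f‖ (norm_nonneg _)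
        fun x y => by
          rw [sub_sub_sub_cancel_right, ← dist_smul g x y]
          exact f.abs_sub_le _ _
      map_add' := fun f h => Lip0.ext fun x => add_sub_add_comm _ _ _ _
      map_smul' := fun c f => Lip0.ext fun x => (mul_sub c (f (g • x)) (f (g • o))).symm }
    1 fun f => by
      rw [one_mul]
      refine Lip0.norm_le _ (norm_nonneg _) fun x y => ?_
      change |(f (g • x) - f (g • o)) - (f (g • y) - f (g • o))| ≤ _
      rw [sub_sub_sub_cancel_right, ← dist_smul g x y]
      exact f.abs_sub_le _ _

@[simp] theorem lipShift_apply (g : G) (f : Lip0 M o) (m : M) :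
    lipShift o g f m = f (g • m) - f (g • o) := rfl

theorem norm_lipShift_le (g : G) : ‖lipShift o g‖ ≤ 1 :=
  LinearMap.mkContinuous_norm_le _ zero_le_one _

theorem delta_comp_lipShift (g : G) (m : M) :
    (Lip0.delta o m).comp (lipShift o g) = Lip0.delta o (g • m) - Lip0.delta o (g • o) := rfl

theorem comp_lipShift_mem (g : G) (μ : LipFree M o) :
    μ.1.comp (lipShift o g) ∈
      (Submodule.span ℝ (Set.range (Lip0.delta o))).topologicalClosure := by
  let L : StrongDual ℝ (Lip0 M o) →L[ℝ] StrongDual ℝ (Lip0 M o) :=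
    (ContinuousLinearMap.compL ℝ (Lip0 M o) (Lip0 M o) ℝ).flip (lipShift o g)
  refine map_mem_closure (f := fun ν => L ν) L.continuous μ.2 fun ν hν => ?_
  change L ν ∈ Submodule.span ℝ (Set.range (Lip0.delta o))
  have hle : Submodule.span ℝ (Set.range (Lip0.delta o)) ≤
      (Submodule.span ℝ (Set.range (Lip0.delta o))).comap L.toLinearMap := by
    rw [Submodule.span_le]
    rintro _ ⟨m, rfl⟩
    exact Submodule.sub_mem (Submodule.span ℝ (Set.range (Lip0.delta o)))
      (Submodule.subset_span (Set.mem_range_self (g • m)))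
      (Submodule.subset_span (Set.mem_range_self (g • o)))
  exact hle hν

/-- The linear isometry `T_g` of `F(M)` with `T_g (δ m) = δ (g m) - δ (g o)`
(see `freeT_delta`). -/
def freeT (o : M) (g : G) : LipFree M o →L[ℝ] LipFree M o :=
  LinearMap.mkContinuous
    { toFun := fun μ => ⟨μ.1.comp (lipShift o g), comp_lipShift_mem g μ⟩
      map_add' := fun _ _ => rfl
      map_smul' := fun _ _ => rfl }
    1 fun μ => by
      refine (ContinuousLinearMap.opNorm_comp_le _ _).trans ?_
      rw [mul_comm]
      exact mul_le_mul_of_nonneg_right (norm_lipShift_le g) (norm_nonneg _)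

/-- The canonical point `δ(m)` of `F(M)`. -/
def freeDelta (o m : M) : LipFree M o :=
  ⟨Lip0.delta o m, Submodule.le_topologicalClosure _ (Submodule.subset_span ⟨m, rfl⟩)⟩

theorem freeT_delta (g : G) (m : M) :
    freeT o g (freeDelta o m) = freeDelta o (g • m) - freeDelta o (g • o) := rfl

theorem freeT_apply_apply (g : G) (μ : LipFree M o) (f : Lip0 M o) :
    (freeT o g μ).1 f = μ.1 (lipShift o g f) := rfl

theorem norm_freeT_apply_le (g : G) (μ : LipFree M o) : ‖freeT o g μ‖ ≤ ‖μ‖ := by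
  refine (ContinuousLinearMap.le_opNorm _ _).trans ?_
  have h : ‖freeT o g‖ ≤ 1 := LinearMap.mkContinuous_norm_le _ zero_le_one _
  exact (mul_le_mul_of_nonneg_right h (norm_nonneg _)).trans_eq (one_mul _)

theorem freeT_mul (g h : G) (μ : LipFree M o) :
    freeT o (g * h) μ = freeT o g (freeT o h μ) := by
  refine Subtype.ext (ContinuousLinearMap.ext fun f => ?_)
  rw [freeT_apply_apply, freeT_apply_apply, freeT_apply_apply]
  congr 1
  ext m
  simp only [lipShift_apply, mul_smul]
  ring

theorem freeT_continuous [TopologicalSpace G] [ContinuousSMul G M] (μ : LipFree M o) :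
    Continuous fun g : G => freeT o g μ := by
  have hδ : Continuous fun m : M => Lip0.delta o m := by
    refine (LipschitzWith.of_dist_le_mul (K := 1) fun x y => ?_).continuous
    rw [dist_eq_norm, NNReal.coe_one, one_mul]
    exact Lip0.norm_delta_sub_le x y
  have hspan : ∀ ν ∈ Submodule.span ℝ (Set.range (Lip0.delta o)),
      Continuous fun g : G => ν.comp (lipShift o g) := by
    intro ν hν
    induction hν using Submodule.span_induction with
    | mem x hx =>
      obtain ⟨m, rfl⟩ := hx
      simp only [delta_comp_lipShift]
      exact (hδ.comp (continuous_id.smul continuous_const)).sub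
        (hδ.comp (continuous_id.smul continuous_const))
    | zero => simpa using continuous_const
    | add x y _ _ hx hy => simp only [ContinuousLinearMap.add_comp]; exact hx.add hy
    | smul c x _ hx => simp only [ContinuousLinearMap.smul_comp]; exact hx.const_smul c
  refine Continuous.subtype_mk (f := fun g : G => μ.1.comp (lipShift o g)) ?_ _
  rw [continuous_iff_continuousAt]
  intro g
  rw [Metric.continuousAt_iff']
  intro ε hε
  obtain ⟨ν, hν, hd⟩ := Metric.mem_closure_iff.1 μ.2 (ε / 3) (by positivity)
  rw [dist_eq_norm] at hd
  have hb : ∀ h : G, dist (μ.1.comp (lipShift o h)) (ν.comp (lipShift o h)) < ε / 3 := by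
    intro h
    rw [dist_eq_norm, ← ContinuousLinearMap.sub_comp]
    refine (ContinuousLinearMap.opNorm_comp_le _ _).trans_lt (lt_of_le_of_lt ?_ hd)
    exact (mul_le_mul_of_nonneg_left (norm_lipShift_le h) (norm_nonneg _)).trans_eq (mul_one _)
  filter_upwards [Metric.continuousAt_iff'.1 (hspan ν hν).continuousAt (ε / 3) (by positivity)]
    with h hh
  have h1 := dist_triangle4 (μ.1.comp (lipShift o h)) (ν.comp (lipShift o h))
    (ν.comp (lipShift o g)) (μ.1.comp (lipShift o g))
  have h2 := hb h
  have h3 := hb g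
  rw [dist_comm] at h3
  linarith

end Action

/-! ## The metric quotient `M/G` -/

/-- The set `M/G` of closures of orbits. -/
def OrbitSpace (G M : Type*) [Group G] [MetricSpace M] [MulAction G M] : Type _ :=
  {S : Set M // ∃ x : M, S = closure (MulAction.orbit G x)}

namespace OrbitSpace

variable {G M : Type*} [Group G] [MetricSpace M] [MulAction G M]

/-- The point `[Gx]` of `M/G`. -/
def mk (G : Type*) {M : Type*} [Group G] [MetricSpace M] [MulAction G M] (x : M) :
    OrbitSpace G M := ⟨closure (MulAction.orbit G x), x, rfl⟩

theorem exists_mk (S : OrbitSpace G M) : ∃ x : M, S = mk G x := by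
  obtain ⟨_, x, rfl⟩ := S
  exact ⟨x, rfl⟩

/-- `d([Gx], [Gy])` is the infimum of `d(x', y')` over `x' ∈ [Gx]` and `y' ∈ [Gy]`. -/
instance : Dist (OrbitSpace G M) := ⟨fun S T => ⨅ p : S.1 × T.1, dist (p.1 : M) (p.2 : M)⟩

theorem dist_def (S T : OrbitSpace G M) :
    dist S T = ⨅ p : S.1 × T.1, dist (p.1 : M) (p.2 : M) := rfl

theorem dist_le_of_mem {S T : OrbitSpace G M} {a b : M} (ha : a ∈ S.1) (hb : b ∈ T.1) :
    dist S T ≤ dist a b :=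
  ciInf_le (f := fun p : S.1 × T.1 => dist (p.1 : M) (p.2 : M))
    ⟨0, by rintro _ ⟨p, rfl⟩; exact dist_nonneg⟩ (⟨⟨a, ha⟩, ⟨b, hb⟩⟩ : S.1 × T.1)

theorem smul_mem_mk (g : G) (x : M) : g • x ∈ (mk G x).1 :=
  subset_closure (MulAction.mem_orbit x g)

theorem self_mem_mk (x : M) : x ∈ (mk G x).1 :=
  subset_closure (MulAction.mem_orbit_self x)

theorem dist_mk_le (x y : M) : dist (mk G x) (mk G y) ≤ dist x y :=
  dist_le_of_mem (self_mem_mk x) (self_mem_mk y)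

variable [IsIsometricSMul G M]

theorem exists_dist_smul_lt (x y : M) {ε : ℝ} (hε : 0 < ε) :
    ∃ g : G, dist x (g • y) < dist (mk G x) (mk G y) + ε := by
  have : Nonempty ((mk G x).1 × (mk G y).1) := ⟨⟨⟨x, self_mem_mk x⟩, ⟨y, self_mem_mk y⟩⟩⟩
  obtain ⟨⟨⟨a, ha⟩, ⟨b, hb⟩⟩, hab⟩ := exists_lt_of_ciInf_lt
    (show (⨅ p : (mk G x).1 × (mk G y).1, dist (p.1 : M) (p.2 : M)) <
      dist (mk G x) (mk G y) + ε / 3 from lt_add_of_pos_right _ (by positivity))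
  obtain ⟨_, ⟨g, rfl⟩, hg⟩ := Metric.mem_closure_iff.1 ha (ε / 3) (by positivity)
  obtain ⟨_, ⟨h, rfl⟩, hh⟩ := Metric.mem_closure_iff.1 hb (ε / 3) (by positivity)
  refine ⟨g⁻¹ * h, ?_⟩
  have h0 : dist x ((g⁻¹ * h) • y) = dist (g • x) (h • y) := by
    rw [← dist_smul g x, smul_smul, mul_inv_cancel_left]
  have h1 := dist_triangle4 (g • x) a b (h • y)
  rw [dist_comm] at hg
  simp only at hab hg hh
  rw [h0]
  linarith

theorem mk_le_mk_of_dist_le {x y : M} (h : dist (mk G x) (mk G y) ≤ 0) :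
    (mk G x).1 ⊆ (mk G y).1 := by
  refine closure_minimal ?_ isClosed_closure
  rintro _ ⟨k, rfl⟩
  refine Metric.mem_closure_iff.2 fun ε hε => ?_
  obtain ⟨g, hg⟩ := exists_dist_smul_lt (G := G) x y hε
  refine ⟨(k * g) • y, ⟨k * g, rfl⟩, ?_⟩
  change dist (k • x) _ < ε
  rw [mul_smul, dist_smul]
  linarith

theorem dist_comm' (S T : OrbitSpace G M) : dist S T ≤ dist T S := by
  obtain ⟨x, rfl⟩ := exists_mk S
  obtain ⟨y, rfl⟩ := exists_mk T
  refine le_of_forall_pos_le_add fun ε hε => ?_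
  obtain ⟨g, hg⟩ := exists_dist_smul_lt (G := G) y x hε
  refine (dist_le_of_mem (smul_mem_mk g x) (self_mem_mk y)).trans ?_
  rw [dist_comm]
  exact hg.le

instance : MetricSpace (OrbitSpace G M) where
  dist_self S := by
    obtain ⟨x, rfl⟩ := exists_mk S
    exact le_antisymm ((dist_mk_le x x).trans_eq (dist_self x))
      (Real.iInf_nonneg fun _ => dist_nonneg)
  dist_comm S T := le_antisymm (dist_comm' S T) (dist_comm' T S)
  dist_triangle S T U := by
    obtain ⟨x, rfl⟩ := exists_mk S
    obtain ⟨y, rfl⟩ := exists_mk T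
    obtain ⟨z, rfl⟩ := exists_mk U
    refine le_of_forall_pos_le_add fun ε hε => ?_
    obtain ⟨g, hg⟩ := exists_dist_smul_lt (G := G) x y (half_pos hε)
    obtain ⟨h, hh⟩ := exists_dist_smul_lt (G := G) y z (half_pos hε)
    have h1 := dist_le_of_mem (self_mem_mk (G := G) x) (smul_mem_mk (g * h) z)
    have h2 := dist_triangle x (g • y) ((g * h) • z)
    rw [mul_smul, dist_smul g y (h • z)] at h2
    rw [mul_smul] at h1
    linarith
  eq_of_dist_eq_zero {S T} hST := by
    obtain ⟨x, rfl⟩ := exists_mk S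
    obtain ⟨y, rfl⟩ := exists_mk T
    exact Subtype.ext (Set.Subset.antisymm (mk_le_mk_of_dist_le hST.le)
      (mk_le_mk_of_dist_le ((dist_comm' _ _).trans hST.le)))

end OrbitSpace

/-- The space `Lip₀ᴳ(M)` of `G`-invariant functions in `Lip₀(M)`. -/
def lip0Inv (G : Type*) {M : Type*} [Group G] [MetricSpace M] [MulAction G M] (o : M) :
    Submodule ℝ (Lip0 M o) where
  carrier := {f | ∀ (g : G) (x : M), f (g • x) = f x}
  zero_mem' := fun _ _ => rfl
  add_mem' := fun {f h} hf hh g x => by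
    rw [Lip0.add_apply, Lip0.add_apply, hf, hh]
  smul_mem' := fun c f hf g x => by
    rw [Lip0.smul_apply, Lip0.smul_apply, hf]

/-- The map `Ψ : Lip₀(M/G) → Lip₀ᴳ(M)`, `Ψ(f)(x) = f([Gx])`; the base point of `M/G`
is `[Go]`. -/
def Psi (G : Type*) {M : Type*} [Group G] [MetricSpace M] [MulAction G M] [IsIsometricSMul G M]
    (o : M) : Lip0 (OrbitSpace G M) (OrbitSpace.mk G o) →ₗ[ℝ] lip0Inv G o where
  toFun f := ⟨Lip0.mk' (fun x => f (OrbitSpace.mk G x)) f.base_apply ‖f‖ (norm_nonneg _)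
      fun x y => (f.abs_sub_le _ _).trans
        (mul_le_mul_of_nonneg_left (OrbitSpace.dist_mk_le x y) (norm_nonneg _)),
    fun g _ => congrArg f.1 (Subtype.ext (congrArg closure (MulAction.orbit_eq_iff.2 ⟨g, rfl⟩)))⟩
  map_add' _ _ := rfl
  map_smul' _ _ := rfl

/-! ## Invariant means -/

/-- The Banach space `ℓ_∞(G)`. -/
abbrev LInf (G : Type*) : Type _ := lp (fun _ : G => ℝ) ∞

namespace LInf

variable {G : Type*}

theorem abs_apply_le (f : LInf G) (h : G) : |f h| ≤ ‖f‖ :=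
  lp.norm_apply_le_norm ENNReal.top_ne_zero f h

/-- Build an element of `ℓ_∞(G)` from a bounded function. -/
def mk' (f : G → ℝ) (C : ℝ) (h : ∀ g, |f g| ≤ C) : LInf G :=
  ⟨f, memℓp_infty ⟨C, by rintro _ ⟨g, rfl⟩; exact h g⟩⟩

variable [Group G]

/-- The left shift `(g · f)(h) = f(g⁻¹ h)`. -/
def leftShift (g : G) : LInf G →ₗ[ℝ] LInf G where
  toFun f := mk' (fun h => f (g⁻¹ * h)) ‖f‖ fun _ => abs_apply_le f _
  map_add' _ _ := rfl
  map_smul' _ _ := rfl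

/-- The right shift `(f · g)(h) = f(h g⁻¹)`. -/
def rightShift (g : G) : LInf G →ₗ[ℝ] LInf G where
  toFun f := mk' (fun h => f (h * g⁻¹)) ‖f‖ fun _ => abs_apply_le f _
  map_add' _ _ := rfl
  map_smul' _ _ := rfl

@[simp] theorem leftShift_apply (g h : G) (f : LInf G) : leftShift g f h = f (g⁻¹ * h) := rfl

@[simp] theorem rightShift_apply (g h : G) (f : LInf G) : rightShift g f h = f (h * g⁻¹) := rfl

end LInf

section Means

variable (G : Type*) [Group G] [TopologicalSpace G]

/-- The space `C^b_{lu}(G)` of those `f ∈ ℓ_∞(G)` for which `x ↦ x⁻¹ · f` is norm continuous. -/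
def Cblu : Submodule ℝ (LInf G) where
  carrier := {f | Continuous fun x : G => LInf.leftShift x⁻¹ f}
  zero_mem' := by
    change Continuous _
    simpa only [map_zero] using continuous_const
  add_mem' := fun {f h} hf hh => by
    change Continuous _
    simp only [map_add]
    exact Continuous.add hf hh
  smul_mem' := fun c f hf => by
    change Continuous _
    simp only [map_smul]
    exact Continuous.const_smul hf c

/-- The space `C^b_{ru}(G)` of those `f ∈ ℓ_∞(G)` for which `x ↦ f · x⁻¹` is norm continuous. -/
def Cbru : Submodule ℝ (LInf G) where
  carrier := {f | Continuous fun x : G => LInf.rightShift x⁻¹ f}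
  zero_mem' := by
    change Continuous _
    simpa only [map_zero] using continuous_const
  add_mem' := fun {f h} hf hh => by
    change Continuous _
    simp only [map_add]
    exact Continuous.add hf hh
  smul_mem' := fun c f hf => by
    change Continuous _
    simp only [map_smul]
    exact Continuous.const_smul hf c

/-- The space `C^b_u(G) = C^b_{lu}(G) ∩ C^b_{ru}(G)`. -/
def Cbu : Submodule ℝ (LInf G) := Cblu G ⊓ Cbru G

/-- `G` is amenable: there is a left-invariant mean on `C^b_{lu}(G)`. -/
def IsAmenable : Prop :=
  ∃ m : Cblu G →ₗ[ℝ] ℝ,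
    (∀ f : Cblu G, (∀ h, f.1 h = 1) → m f = 1) ∧
    (∀ f : Cblu G, (∀ h, 0 ≤ f.1 h) → 0 ≤ m f) ∧
    ∀ (g : G) (f f' : Cblu G), f'.1 = LInf.leftShift g f.1 → m f' = m f

/-- `G` is SIN: it has small invariant neighbourhoods of the identity. -/
def IsSIN : Prop :=
  ∀ U ∈ 𝓝 (1 : G), ∃ V ∈ 𝓝 (1 : G), V ⊆ U ∧ ∀ g : G, (fun v => g * v * g⁻¹) '' V = V

/-- A bi-invariant mean on `C^b_u(G)`. -/
structure UniformMean where
  /-- the underlying functional -/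
  toLin : Cbu G →ₗ[ℝ] ℝ
  map_one : ∀ f : Cbu G, (∀ h, f.1 h = 1) → toLin f = 1
  map_nonneg : ∀ f : Cbu G, (∀ h, 0 ≤ f.1 h) → 0 ≤ toLin f
  left_inv : ∀ (g : G) (f f' : Cbu G), f'.1 = LInf.leftShift g f.1 → toLin f' = toLin f
  right_inv : ∀ (g : G) (f f' : Cbu G), f'.1 = LInf.rightShift g f.1 → toLin f' = toLin f

/-- A bi-invariant mean on `L_∞(G)`, taken with respect to Haar measure, of a locally compact
group. The elements `f'` in `left_inv` and `right_inv` are the shifts `g · f` and `f · g`. -/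
structure LInftyMean [IsTopologicalGroup G] [MeasurableSpace G] [BorelSpace G]
    [LocallyCompactSpace G] where
  /-- the underlying functional -/
  toLin : Lp ℝ ∞ (Measure.haar : Measure G) →ₗ[ℝ] ℝ
  map_one : ∀ f : Lp ℝ ∞ (Measure.haar : Measure G),
    (∀ᵐ h ∂(Measure.haar : Measure G), f h = 1) → toLin f = 1
  map_nonneg : ∀ f : Lp ℝ ∞ (Measure.haar : Measure G),
    (∀ᵐ h ∂(Measure.haar : Measure G), 0 ≤ f h) → 0 ≤ toLin f
  left_inv : ∀ (g : G) (f f' : Lp ℝ ∞ (Measure.haar : Measure G)),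
    (∀ᵐ h ∂(Measure.haar : Measure G), f' h = f (g⁻¹ * h)) → toLin f' = toLin f
  right_inv : ∀ (g : G) (f f' : Lp ℝ ∞ (Measure.haar : Measure G)),
    (∀ᵐ h ∂(Measure.haar : Measure G), f' h = f (h * g⁻¹)) → toLin f' = toLin f

/-- A bi-invariant mean on a group that is locally compact or SIN: in the first case it is
defined on `L_∞(G)`, in the second case on `C^b_u(G)`. -/
inductive BiInvariantMean [IsTopologicalGroup G] [MeasurableSpace G] [BorelSpace G] where
  | ofLocallyCompact (inst : LocallyCompactSpace G) (m : LInftyMean G) : BiInvariantMean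
  | ofSIN (h : IsSIN G) (m : UniformMean G) : BiInvariantMean

variable {G}

theorem Cbru.continuous {f : LInf G} (hf : f ∈ Cbru G) : Continuous fun h => f h := by
  have hc : Continuous fun x : G => LInf.rightShift x⁻¹ f := hf
  rw [continuous_iff_continuousAt] at hc ⊢
  intro x
  have hx := hc x
  rw [Metric.continuousAt_iff'] at hx ⊢
  intro ε hε
  filter_upwards [hx ε hε] with y hy
  refine lt_of_le_of_lt ?_ hy
  have h1 := LInf.abs_apply_le (LInf.rightShift y⁻¹ f - LInf.rightShift x⁻¹ f) 1
  have h2 : (LInf.rightShift y⁻¹ f - LInf.rightShift x⁻¹ f) 1 = f y - f x := by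
    change f (1 * y⁻¹⁻¹) - f (1 * x⁻¹⁻¹) = _
    simp
  rw [h2] at h1
  rwa [Real.dist_eq, dist_eq_norm]

/-- A continuity criterion: it is enough to control shifts by elements close to `1`. -/
theorem mem_Cbru_of_forall [IsTopologicalGroup G] {f : LInf G}
    (H : ∀ ε > 0, ∃ U ∈ 𝓝 (1 : G), ∀ h ∈ U, ∀ g, |f (g * h) - f g| ≤ ε) : f ∈ Cbru G := by
  change Continuous fun x : G => LInf.rightShift x⁻¹ f
  rw [continuous_iff_continuousAt]
  intro x
  rw [Metric.continuousAt_iff']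
  intro ε hε
  obtain ⟨U, hU, h⟩ := H (ε / 2) (by positivity)
  have hx : ∀ᶠ y in 𝓝 x, x⁻¹ * y ∈ U := by
    have hc : ContinuousAt (fun y : G => x⁻¹ * y) x := by fun_prop
    exact hc.eventually_mem (by simpa using hU)
  filter_upwards [hx] with y hy
  rw [dist_eq_norm]
  refine lt_of_le_of_lt ?_ (half_lt_self hε)
  refine lp.norm_le_of_forall_le (by positivity) fun g => ?_
  change |f (g * y⁻¹⁻¹) - f (g * x⁻¹⁻¹)| ≤ _
  have := h _ hy (g * x)
  simpa [mul_assoc] using this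

theorem Cbru_le_Cbu_of_isSIN [IsTopologicalGroup G] (hG : IsSIN G) : Cbru G ≤ Cbu G := by
  intro f hf
  refine ⟨?_, hf⟩
  have hc : Continuous fun x : G => LInf.rightShift x⁻¹ f := hf
  change Continuous fun x : G => LInf.leftShift x⁻¹ f
  rw [continuous_iff_continuousAt]
  intro x
  rw [Metric.continuousAt_iff']
  intro ε hε
  have h1 := Metric.continuousAt_iff'.1 (hc.continuousAt (x := 1)) (ε / 2) (by positivity)
  obtain ⟨V, hV, hVU, hVinv⟩ := hG _ h1
  have hx : ∀ᶠ y in 𝓝 x, y * x⁻¹ ∈ V := by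
    have hc : ContinuousAt (fun y : G => y * x⁻¹) x := by fun_prop
    exact hc.eventually_mem (by simpa using hV)
  filter_upwards [hx] with y hy
  rw [dist_eq_norm]
  refine lt_of_le_of_lt ?_ (half_lt_self hε)
  refine lp.norm_le_of_forall_le (by positivity) fun g => ?_
  change |f (y⁻¹⁻¹ * g) - f (x⁻¹⁻¹ * g)| ≤ _
  have hmem : (x * g)⁻¹ * (y * x⁻¹) * (x * g) ∈ V := by
    rw [← hVinv (x * g)⁻¹]
    exact ⟨_, hy, by simp⟩
  have h2 := hVU hmem
  simp only [Set.mem_ofPred_eq, dist_eq_norm] at h2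
  have h3 := (LInf.abs_apply_le _ (x * g)).trans h2.le
  have h4 : x * g * ((g⁻¹ * (x⁻¹ * (y * (x⁻¹ * (x * g)))))) = y * g := by group
  change |f (x * g * ((x * g)⁻¹ * (y * x⁻¹) * (x * g))⁻¹⁻¹) - f (x * g * 1⁻¹⁻¹)| ≤ _ at h3
  simpa [mul_assoc, h4] using h3

variable [IsTopologicalGroup G] [MeasurableSpace G] [BorelSpace G]

theorem Cbru.memLp [LocallyCompactSpace G] {f : LInf G} (hf : f ∈ Cbru G) :
    MemLp (fun h => f h) ∞ (Measure.haar : Measure G) :=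
  memLp_top_of_bound (Cbru.continuous hf).aestronglyMeasurable ‖f‖
    (Filter.Eventually.of_forall fun h => LInf.abs_apply_le f h)

/-- The value of a bi-invariant mean on functions in `C^b_{ru}(G)`, which belong to `L_∞(G)`
if `G` is locally compact, and to `C^b_u(G)` if `G` is SIN. -/
def BiInvariantMean.eval : BiInvariantMean G → Cbru G →ₗ[ℝ] ℝ
  | .ofLocallyCompact _ m =>
    m.toLin ∘ₗ
      { toFun := fun f => (Cbru.memLp f.2).toLp
        map_add' := fun f h => MemLp.toLp_add (Cbru.memLp f.2) (Cbru.memLp h.2)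
        map_smul' := fun c f => MemLp.toLp_const_smul c (Cbru.memLp f.2) }
  | .ofSIN h m => m.toLin ∘ₗ Submodule.inclusion (Cbru_le_Cbu_of_isSIN h)

theorem BiInvariantMean.eval_one (m : BiInvariantMean G) (f : Cbru G) (hf : ∀ h, f.1 h = 1) :
    m.eval f = 1 := by
  cases m with
  | ofLocallyCompact inst m =>
    refine m.map_one _ ?_
    filter_upwards [(Cbru.memLp f.2).coeFn_toLp] with h hh
    exact hh.trans (hf h)
  | ofSIN h m => exact m.map_one _ hf

theorem BiInvariantMean.eval_nonneg (m : BiInvariantMean G) (f : Cbru G)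
    (hf : ∀ h, 0 ≤ f.1 h) : 0 ≤ m.eval f := by
  cases m with
  | ofLocallyCompact inst m =>
    refine m.map_nonneg _ ?_
    filter_upwards [(Cbru.memLp f.2).coeFn_toLp] with h hh
    exact (hf h).trans_eq hh.symm
  | ofSIN h m => exact m.map_nonneg _ hf

theorem BiInvariantMean.abs_eval_le (m : BiInvariantMean G) (f : Cbru G) {C : ℝ}
    (hf : ∀ h, |f.1 h| ≤ C) : |m.eval f| ≤ C := by
  let u : Cbru G := ⟨LInf.mk' (fun _ => 1) 1 (by simp), mem_Cbru_of_forall fun ε hε =>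
    ⟨Set.univ, Filter.univ_mem, fun h _ g => by
      change |(1 : ℝ) - 1| ≤ ε
      simpa using hε.le⟩⟩
  have hu : m.eval u = 1 := m.eval_one u fun _ => rfl
  have h1 := m.eval_nonneg (C • u - f) fun h => by
    change 0 ≤ C * 1 - f.1 h
    linarith [(abs_le.1 (hf h)).2]
  have h2 := m.eval_nonneg (C • u + f) fun h => by
    change 0 ≤ C * 1 + f.1 h
    linarith [(abs_le.1 (hf h)).1]
  rw [map_sub, map_smul, hu, smul_eq_mul] at h1
  rw [map_add, map_smul, hu, smul_eq_mul] at h2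
  exact abs_le.2 ⟨by linarith, by linarith⟩

end Means

/-! ## The operators `R_G` and `P_G` -/

section Operators

variable {G M : Type*} [Group G] [TopologicalSpace G] [IsTopologicalGroup G]
  [MetricSpace M] [MulAction G M] [IsIsometricSMul G M] [ContinuousSMul G M]

theorem abs_apply_freeT_le {G M : Type*} [Group G] [MetricSpace M] [MulAction G M]
    [IsIsometricSMul G M] {o : M} (x : LipFree M o) (φ : StrongDual ℝ (LipFree M o)) (g : G) :
    |φ (freeT o g x)| ≤ ‖x‖ * ‖φ‖ := by
  rw [mul_comm]
  exact (φ.le_opNorm _).trans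
    (mul_le_mul_of_nonneg_left (norm_freeT_apply_le g x) (norm_nonneg _))

/-- The function `g ↦ φ(T_g x)` as an element of `C^b_{ru}(G)`. -/
def orbitFun (G : Type*) {M : Type*} [Group G] [TopologicalSpace G] [IsTopologicalGroup G]
    [MetricSpace M] [MulAction G M] [IsIsometricSMul G M] [ContinuousSMul G M] {o : M}
    (x : LipFree M o) (φ : StrongDual ℝ (LipFree M o)) : Cbru G :=
  ⟨LInf.mk' (fun g => φ (freeT o g x)) (‖x‖ * ‖φ‖) (abs_apply_freeT_le x φ),
    mem_Cbru_of_forall fun ε hε => by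
      have hone : freeT o (1 : G) x = x := by
        refine Subtype.ext (ContinuousLinearMap.ext fun f => ?_)
        rw [freeT_apply_apply]
        congr 1
        ext m
        simp
      have hc := Metric.continuousAt_iff'.1
        ((freeT_continuous (G := G) x).continuousAt (x := 1)) (ε / (‖φ‖ + 1)) (by positivity)
      refine ⟨_, hc, fun h hh g => ?_⟩
      simp only [Set.mem_ofPred_eq, hone, dist_eq_norm] at hh
      change |φ (freeT o (g * h) x) - φ (freeT o g x)| ≤ ε
      rw [freeT_mul, ← map_sub, ← map_sub]
      refine (abs_apply_freeT_le _ φ g).trans ?_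
      rw [lt_div_iff₀ (by positivity)] at hh
      nlinarith [norm_nonneg (freeT o h x - x), norm_nonneg φ]⟩

variable [MeasurableSpace G] [BorelSpace G]

/-- The operator `R_G : F(M) → F(M)**`, `R_G(x)(φ) = m(g ↦ φ(T_g x))`. -/
def opR (m : BiInvariantMean G) (o : M) :
    LipFree M o →L[ℝ] StrongDual ℝ (StrongDual ℝ (LipFree M o)) :=
  LinearMap.mkContinuous₂
    (LinearMap.mk₂ ℝ (fun x φ => m.eval (orbitFun G x φ))
      (fun x y φ => by
        rw [← map_add]
        congr 1
        exact Subtype.ext (lp.ext (funext fun g => by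
          change φ (freeT o g (x + y)) = φ (freeT o g x) + φ (freeT o g y)
          rw [map_add, map_add])))
      (fun c x φ => by
        rw [← map_smul]
        congr 1
        exact Subtype.ext (lp.ext (funext fun g => by
          change φ (freeT o g (c • x)) = c • φ (freeT o g x)
          rw [map_smul, map_smul])))
      (fun x φ ψ => by rw [← map_add]; rfl)
      (fun c x φ => by rw [← map_smul]; rfl))
    1 fun x φ => by
      rw [one_mul]
      exact m.abs_eval_le (orbitFun G x φ) (abs_apply_freeT_le x φ)

theorem opR_apply (m : BiInvariantMean G) (o : M) (x : LipFree M o)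
    (φ : StrongDual ℝ (LipFree M o)) : opR m o x φ = m.eval (orbitFun G x φ) := rfl

/-- The operator `P_G = Q ∘ R_G : F(M) → F(M)`. -/
def opP (m : BiInvariantMean G) (o : M)
    (Q : StrongDual ℝ (StrongDual ℝ (LipFree M o)) →L[ℝ] LipFree M o) :
    LipFree M o →L[ℝ] LipFree M o :=
  Q.comp (opR m o)

end Operators

/-- The bidual `T** : X** → X**` of an operator `T : X → X`, `(T** z)(φ) = z(φ ∘ T)`. -/
def bidualMap {X : Type*} [NormedAddCommGroup X] [NormedSpace ℝ X] (T : X →L[ℝ] X)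
    (z : StrongDual ℝ (StrongDual ℝ X)) : StrongDual ℝ (StrongDual ℝ X) :=
  z.comp ((ContinuousLinearMap.compL ℝ X X ℝ).flip T)

theorem bidualMap_apply {X : Type*} [NormedAddCommGroup X] [NormedSpace ℝ X] (T : X →L[ℝ] X)
    (z : StrongDual ℝ (StrongDual ℝ X)) (φ : StrongDual ℝ X) :
    bidualMap T z φ = z (φ.comp T) := rfl

end

/-! ## Duality between `F(M)` and `Lip₀(M)` -/

namespace LipFree

variable {M : Type*} [MetricSpace M] {o : M}

/-! Let q = `freeQuot` : F(M) → F(M/G) send δ(x) to δ([Gx]). Its adjoint is `Ψ`, which maps onto the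
invariant functions without loss of norm, so ker q = Lip₀ᴳ(M)_⊥. The theorem compares P = P_G with
q.

Right invariance of the mean gives P T_g = P. Left invariance makes R_G μ fixed by T_g**, and
invariance of ker Q carries this down to T_g P = P (`freeT_opP`). On fixed vectors R_G is the
canonical embedding, so P is a projection (`opP_opP`).

By P T_g = P, each functional φ ∘ P is represented by an f with f(gx) - f(go) = f(x); bounded orbits
force f(go) = 0, so f is invariant and φ ∘ P factors through q. Hence ‖Pμ‖ ≤ ‖P‖ ‖qμ‖
(`norm_apply_le_norm_freeQuot`), and ker q ⊂ ker P. The set Y supplies the converse ker P ⊂ ker q.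
Then qP = q, and q restricted to the range of P is bounded below by 1/‖P‖ and has dense range, so it
is an isomorphism onto F(M/G) (`exists_equiv_range`). Its inverse has norm at most ‖P‖ ≤ ‖Q‖. -/

instance instCompleteSpace : CompleteSpace (LipFree M o) :=
  inferInstanceAs (CompleteSpace
    (Submodule.span ℝ (Set.range (Lip0.delta o))).topologicalClosure)

theorem norm_freeDelta_sub_le (x y : M) : ‖freeDelta o x - freeDelta o y‖ ≤ dist x y :=
  Lip0.norm_delta_sub_le x y

theorem freeDelta_base : freeDelta o o = 0 :=
  Subtype.ext (ContinuousLinearMap.ext fun f => f.base_apply)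

/-- The pairing with a Lipschitz function, as a continuous functional on `F(M)`. -/
noncomputable def pairing (f : Lip0 M o) : StrongDual ℝ (LipFree M o) :=
  LinearMap.mkContinuous
    { toFun := fun μ => μ.1 f
      map_add' := fun _ _ => rfl
      map_smul' := fun _ _ => rfl } ‖f‖ fun μ => by
    rw [mul_comm]
    exact μ.1.le_opNorm f

theorem dense_span_freeDelta :
    Dense (Submodule.span ℝ (Set.range (freeDelta o)) : Set (LipFree M o)) := by
  intro μ
  rw [Metric.mem_closure_iff]
  intro ε hε
  obtain ⟨ν, hν, hd⟩ := Metric.mem_closure_iff.1 μ.2 ε hε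
  have key : ∃ ν' ∈ Submodule.span ℝ (Set.range (freeDelta o)), ν'.1 = ν := by
    clear hd
    change ν ∈ Submodule.span ℝ (Set.range (Lip0.delta o)) at hν
    induction hν using Submodule.span_induction with
    | mem x hx =>
      obtain ⟨m, rfl⟩ := hx
      exact ⟨freeDelta o m, Submodule.subset_span ⟨m, rfl⟩, rfl⟩
    | zero => exact ⟨0, Submodule.zero_mem _, rfl⟩
    | add x y _ _ hx hy =>
      obtain ⟨x', hx', rfl⟩ := hx
      obtain ⟨y', hy', rfl⟩ := hy
      exact ⟨x' + y', Submodule.add_mem _ hx' hy', rfl⟩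
    | smul c x _ hx =>
      obtain ⟨x', hx', rfl⟩ := hx
      exact ⟨c • x', Submodule.smul_mem _ c hx', rfl⟩
  obtain ⟨ν', hν', rfl⟩ := key
  exact ⟨ν', hν', hd⟩

/-- Continuous linear maps on `F(M)` are determined by their values on the points of `M`. -/
theorem clm_ext {E : Type*} [NormedAddCommGroup E] [NormedSpace ℝ E]
    {S T : LipFree M o →L[ℝ] E} (h : ∀ x, S (freeDelta o x) = T (freeDelta o x)) : S = T :=
  ContinuousLinearMap.ext_on dense_span_freeDelta (by rintro _ ⟨x, rfl⟩; exact h x)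

/-- The Lipschitz function `x ↦ φ(δ(x))` representing a functional `φ` on `F(M)`. -/
noncomputable def ofDual (φ : StrongDual ℝ (LipFree M o)) : Lip0 M o :=
  Lip0.mk' (fun x => φ (freeDelta o x)) (by rw [freeDelta_base, map_zero]) ‖φ‖ (norm_nonneg _)
    fun x y => by
      rw [← map_sub]
      exact (φ.le_opNorm _).trans
        (mul_le_mul_of_nonneg_left (norm_freeDelta_sub_le x y) (norm_nonneg _))

theorem ofDual_apply (φ : StrongDual ℝ (LipFree M o)) (x : M) :
    ofDual φ x = φ (freeDelta o x) := rfl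

theorem norm_ofDual_le (φ : StrongDual ℝ (LipFree M o)) : ‖ofDual φ‖ ≤ ‖φ‖ :=
  Lip0.norm_le _ (norm_nonneg _) fun x y => by
    rw [ofDual_apply, ofDual_apply, ← map_sub]
    exact (φ.le_opNorm _).trans
      (mul_le_mul_of_nonneg_left (norm_freeDelta_sub_le x y) (norm_nonneg _))

/-- Together with `norm_ofDual_le` this is the half of F(M)* = Lip₀(M) that is needed: functionals
are Lipschitz functions of no larger norm. -/
theorem pairing_ofDual (φ : StrongDual ℝ (LipFree M o)) : pairing (ofDual φ) = φ :=
  clm_ext fun _ => rfl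

theorem apply_ofDual (φ : StrongDual ℝ (LipFree M o)) (μ : LipFree M o) :
    μ.1 (ofDual φ) = φ μ :=
  congrArg (fun ψ : StrongDual ℝ (LipFree M o) => ψ μ) (pairing_ofDual φ)

end LipFree

/-! ## The quotient map `F(M) → F(M/G)` -/

section Quotient

variable {G M : Type*} [Group G] [MetricSpace M] [MulAction G M] {o : M}

/-- A Lipschitz function `f` with `f (g x) - f (g o) = f x` is invariant if the orbit of the base
point is bounded. -/
theorem mem_lip0Inv_of_forall_sub (hbdd : Bornology.IsBounded (MulAction.orbit G o))
    {f : Lip0 M o} (h : ∀ (g : G) (x : M), f (g • x) - f (g • o) = f x) :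
    f ∈ lip0Inv G o := by
  -- On the orbit of `o` the hypothesis says that g ↦ f(go) is a homomorphism into ℝ. Along the
  -- powers of g it grows linearly unless it vanishes, and a bounded orbit excludes growth.
  have hpow : ∀ (g : G) (n : ℕ), f (g ^ n • o) = n * f (g • o) := by
    intro g n
    induction n with
    | zero => simp
    | succ n ih =>
      have := h g (g ^ n • o)
      rw [smul_smul, ← pow_succ', ih] at this
      push_cast
      linarith
  have hzero : ∀ g : G, f (g • o) = 0 := by
    intro g
    obtain ⟨C, hC⟩ := Metric.isBounded_iff.1 hbdd
    have hb : ∀ n : ℕ, n * |f (g • o)| ≤ ‖f‖ * C := by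
      intro n
      have h1 := f.abs_sub_le (g ^ n • o) o
      rw [f.base_apply, sub_zero, hpow, abs_mul, Nat.abs_cast] at h1
      exact h1.trans (mul_le_mul_of_nonneg_left
        (hC (MulAction.mem_orbit o _) (MulAction.mem_orbit_self o)) (norm_nonneg _))
    by_contra hne
    obtain ⟨n, hn⟩ := exists_nat_gt (‖f‖ * C / |f (g • o)|)
    rw [div_lt_iff₀ (abs_pos.2 hne)] at hn
    exact absurd (hb n) (not_le.2 hn)
  intro g x
  have := h g x
  rwa [hzero, sub_zero] at this

variable [IsIsometricSMul G M]

theorem norm_Psi_le (f : Lip0 (OrbitSpace G M) (OrbitSpace.mk G o)) :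
    ‖(Psi G o f : Lip0 M o)‖ ≤ ‖f‖ :=
  Lip0.norm_le _ (norm_nonneg _) fun x y => (f.abs_sub_le _ _).trans
    (mul_le_mul_of_nonneg_left (OrbitSpace.dist_mk_le x y) (norm_nonneg _))

/-- Every invariant function in `Lip₀(M)` comes from `Lip₀(M/G)`, without increase of norm. -/
theorem exists_Psi_eq {f : Lip0 M o} (hf : f ∈ lip0Inv G o) :
    ∃ F : Lip0 (OrbitSpace G M) (OrbitSpace.mk G o), (Psi G o F : Lip0 M o) = f ∧ ‖F‖ ≤ ‖f‖ := by
  -- Moving y along its orbit does not change f(y) and brings d(x, gy) as close as desired to the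
  -- quotient distance.
  have hb : ∀ x y : M, |f x - f y| ≤ ‖f‖ * dist (OrbitSpace.mk G x) (OrbitSpace.mk G y) := by
    intro x y
    refine le_of_forall_pos_le_add fun ε hε => ?_
    obtain ⟨g, hg⟩ := OrbitSpace.exists_dist_smul_lt (G := G) x y
      (show 0 < ε / (‖f‖ + 1) by positivity)
    have h1 := f.abs_sub_le x (g • y)
    rw [hf g y] at h1
    have h2 := mul_le_mul_of_nonneg_left hg.le (norm_nonneg f)
    have h3 : ‖f‖ * (ε / (‖f‖ + 1)) ≤ ε := by
      rw [← mul_div_assoc, div_le_iff₀ (by positivity)]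
      nlinarith [norm_nonneg f]
    rw [mul_add] at h2
    linarith
  -- The function on M/G is f at a chosen representative; `hb` at distance zero shows that the
  -- choice is immaterial.
  choose r hr using OrbitSpace.exists_mk (G := G) (M := M)
  have hfr : ∀ x, f (r (OrbitSpace.mk G x)) = f x := by
    intro x
    have h1 := hb (r (OrbitSpace.mk G x)) x
    rw [← hr, dist_self, mul_zero] at h1
    exact sub_eq_zero.1 (abs_eq_zero.1 (le_antisymm h1 (abs_nonneg _)))
  have hF : ∀ S T : OrbitSpace G M, |f (r S) - f (r T)| ≤ ‖f‖ * dist S T := by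
    intro S T
    have h1 := hb (r S) (r T)
    rwa [← hr, ← hr] at h1
  exact ⟨Lip0.mk' (fun S => f (r S)) ((hfr o).trans f.base_apply) ‖f‖ (norm_nonneg _) hF,
    Lip0.ext hfr, Lip0.norm_le _ (norm_nonneg _) hF⟩

/-- `Ψ` as a continuous linear map into `Lip₀(M)`. -/
noncomputable def psiL (G : Type*) {M : Type*} [Group G] [MetricSpace M] [MulAction G M] [IsIsometricSMul G M]
    (o : M) : Lip0 (OrbitSpace G M) (OrbitSpace.mk G o) →L[ℝ] Lip0 M o :=
  LinearMap.mkContinuous ((lip0Inv G o).subtype ∘ₗ Psi G o) 1 fun f => by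
    rw [one_mul]
    exact norm_Psi_le f

theorem norm_psiL_le : ‖psiL G o‖ ≤ 1 := LinearMap.mkContinuous_norm_le _ zero_le_one _

/-- Precomposition with `psiL` is norm continuous and takes δ(x) to δ([Gx]), so it respects the
spans and their closures. -/
theorem comp_psiL_mem (μ : LipFree M o) :
    μ.1.comp (psiL G o) ∈ (Submodule.span ℝ
      (Set.range (Lip0.delta (OrbitSpace.mk G o)))).topologicalClosure := by
  let L : StrongDual ℝ (Lip0 M o) →L[ℝ]
      StrongDual ℝ (Lip0 (OrbitSpace G M) (OrbitSpace.mk G o)) :=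
    (ContinuousLinearMap.compL ℝ _ (Lip0 M o) ℝ).flip (psiL G o)
  refine map_mem_closure (f := fun ν => L ν) L.continuous μ.2 fun ν hν => ?_
  have hle : Submodule.span ℝ (Set.range (Lip0.delta o)) ≤
      (Submodule.span ℝ (Set.range (Lip0.delta (OrbitSpace.mk G o)))).comap L.toLinearMap := by
    rw [Submodule.span_le]
    rintro _ ⟨m, rfl⟩
    exact Submodule.subset_span (Set.mem_range_self (OrbitSpace.mk G m))
  exact hle hν

/-- The linear map `F(M) → F(M/G)` with `δ(x) ↦ δ([Gx])`, whose adjoint is `Ψ`. -/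
noncomputable def freeQuot (G : Type*) {M : Type*} [Group G] [MetricSpace M] [MulAction G M]
    [IsIsometricSMul G M] (o : M) :
    LipFree M o →L[ℝ] LipFree (OrbitSpace G M) (OrbitSpace.mk G o) :=
  LinearMap.mkContinuous
    { toFun := fun μ => ⟨μ.1.comp (psiL G o), comp_psiL_mem μ⟩
      map_add' := fun _ _ => rfl
      map_smul' := fun _ _ => rfl }
    1 fun μ => by
      refine (ContinuousLinearMap.opNorm_comp_le _ _).trans ?_
      rw [mul_comm]
      exact mul_le_mul_of_nonneg_right norm_psiL_le (norm_nonneg _)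

theorem freeQuot_apply (μ : LipFree M o) (f : Lip0 (OrbitSpace G M) (OrbitSpace.mk G o)) :
    (freeQuot G o μ).1 f = μ.1 (Psi G o f : Lip0 M o) := rfl

theorem freeQuot_freeDelta (x : M) :
    freeQuot G o (freeDelta o x) = freeDelta (OrbitSpace.mk G o) (OrbitSpace.mk G x) := rfl

theorem norm_freeQuot_le : ‖freeQuot G o‖ ≤ 1 :=
  LinearMap.mkContinuous_norm_le _ zero_le_one _

/-- Since ⟨F, qμ⟩ = ⟨Ψ(F), μ⟩, this is surjectivity of `Ψ` onto the invariant functions. -/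
theorem freeQuot_eq_zero_iff (μ : LipFree M o) :
    freeQuot G o μ = 0 ↔ μ ∈ preannihilator (lip0Inv G o : Set (Lip0 M o)) := by
  constructor
  · intro h f hf
    obtain ⟨F, rfl, -⟩ := exists_Psi_eq hf
    rw [← freeQuot_apply, h]
    rfl
  · intro h
    exact Subtype.ext (ContinuousLinearMap.ext fun F => h _ (Psi G o F).2)

/-- Density suffices later: a lower bound on the range of the projection makes the image closed. -/
theorem dense_range_freeQuot : DenseRange (freeQuot G o) := by
  refine LipFree.dense_span_freeDelta.mono ?_
  change Submodule.span ℝ _ ≤ (freeQuot G o).range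
  rw [Submodule.span_le]
  rintro _ ⟨S, rfl⟩
  obtain ⟨x, rfl⟩ := S.exists_mk
  exact ⟨freeDelta o x, freeQuot_freeDelta x⟩

end Quotient

/-! ## Projections onto the fixed vectors of the action -/

section FixedProjection

variable {G M : Type*} [Group G] [MetricSpace M] [MulAction G M] [IsIsometricSMul G M] {o : M}
  {P : LipFree M o →L[ℝ] LipFree M o}

/-- Tested on δ(x), the identity P T_g = P is invariance up to the term f(go), which
`mem_lip0Inv_of_forall_sub` removes. -/
theorem ofDual_comp_mem_lip0Inv (hbdd : Bornology.IsBounded (MulAction.orbit G o))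
    (hPT : ∀ (g : G) (μ : LipFree M o), P (freeT o g μ) = P μ)
    (φ : StrongDual ℝ (LipFree M o)) : LipFree.ofDual (φ.comp P) ∈ lip0Inv G o := by
  refine mem_lip0Inv_of_forall_sub hbdd fun g x => ?_
  rw [LipFree.ofDual_apply, LipFree.ofDual_apply, ← map_sub, ← freeT_delta]
  exact congrArg φ (hPT g _)

/-- Every φ ∘ P is an invariant function, hence of the form F ∘ q with ‖F‖ ≤ ‖φ‖ ‖P‖, and the φ
compute the norm of Pμ by Hahn–Banach. The estimate serves twice: it gives ker q ⊂ ker P and the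
lower bound for q on the range of P. -/
theorem norm_apply_le_norm_freeQuot (hbdd : Bornology.IsBounded (MulAction.orbit G o))
    (hPT : ∀ (g : G) (μ : LipFree M o), P (freeT o g μ) = P μ) (μ : LipFree M o) :
    ‖P μ‖ ≤ ‖P‖ * ‖freeQuot G o μ‖ := by
  refine NormedSpace.norm_le_dual_bound ℝ _ (by positivity) fun φ => ?_
  obtain ⟨F, hF, hFn⟩ := exists_Psi_eq (ofDual_comp_mem_lip0Inv hbdd hPT φ)
  have h1 : φ (P μ) = (freeQuot G o μ).1 F := by
    rw [freeQuot_apply, hF, LipFree.apply_ofDual]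
    rfl
  have h2 : ‖F‖ ≤ ‖φ‖ * ‖P‖ :=
    (hFn.trans (LipFree.norm_ofDual_le _)).trans (φ.opNorm_comp_le P)
  rw [h1]
  calc ‖(freeQuot G o μ).1 F‖ ≤ ‖freeQuot G o μ‖ * ‖F‖ := (freeQuot G o μ).1.le_opNorm F
    _ ≤ ‖freeQuot G o μ‖ * (‖φ‖ * ‖P‖) := mul_le_mul_of_nonneg_left h2 (norm_nonneg _)
    _ = ‖P‖ * ‖freeQuot G o μ‖ * ‖φ‖ := by ring

/-- If `P` is a projection with `P T_g = P` whose kernel is contained in the kernel of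
`F(M) → F(M/G)`, then that map restricts to an isomorphism from the range of `P` onto `F(M/G)`. -/
theorem exists_equiv_range (hbdd : Bornology.IsBounded (MulAction.orbit G o))
    (hPT : ∀ (g : G) (μ : LipFree M o), P (freeT o g μ) = P μ)
    (hPP : ∀ μ, P (P μ) = P μ) (hker : ∀ μ, P μ = 0 → freeQuot G o μ = 0) :
    ∃ T : LipFree (OrbitSpace G M) (OrbitSpace.mk G o) ≃L[ℝ] P.range,
      ‖(T : LipFree (OrbitSpace G M) (OrbitSpace.mk G o) →L[ℝ] P.range)‖ ≤ ‖P‖ ∧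
      ‖(T.symm : P.range →L[ℝ] LipFree (OrbitSpace G M) (OrbitSpace.mk G o))‖ ≤ 1 := by
  -- Pμ - μ lies in ker P because P is idempotent, hence in ker q.
  have hQP : ∀ μ, freeQuot G o (P μ) = freeQuot G o μ := by
    intro μ
    have h := hker (P μ - μ) (by rw [map_sub, hPP, sub_self])
    rwa [map_sub, sub_eq_zero] at h
  have hidem : IsIdempotentElem P := ContinuousLinearMap.ext hPP
  have hcl : IsClosed (P.range : Set (LipFree M o)) :=
    ContinuousLinearMap.IsIdempotentElem.isClosed_range hidem
  have : CompleteSpace P.range := hcl.completeSpace_coe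
  let q : P.range →L[ℝ] LipFree (OrbitSpace G M) (OrbitSpace.mk G o) :=
    (freeQuot G o).comp P.range.subtypeL
  have hq : ∀ w : P.range, ‖w‖ ≤ ‖P‖ * ‖q w‖ := by
    rintro ⟨_, μ, rfl⟩
    change ‖P μ‖ ≤ ‖P‖ * ‖freeQuot G o (P μ)‖
    rw [hQP]
    exact norm_apply_le_norm_freeQuot hbdd hPT μ
  have hanti : AntilipschitzWith ‖P‖₊ q := q.antilipschitz_of_bound hq
  have hdense : Dense (q.range : Set (LipFree (OrbitSpace G M) (OrbitSpace.mk G o))) := by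
    refine dense_range_freeQuot.mono ?_
    rintro _ ⟨μ, rfl⟩
    exact ⟨⟨P μ, μ, rfl⟩, hQP μ⟩
  -- The range is dense, and it is closed because `q` is bounded below on the complete space
  -- `P.range`.
  have hsurj : q.range = ⊤ := by
    rw [← ContinuousLinearMap.closed_range_of_antilipschitz hanti]
    exact (Submodule.dense_iff_topologicalClosure_eq_top).1 hdense
  have hinj : q.ker = ⊥ := LinearMap.ker_eq_bot.2 hanti.injective
  let e := ContinuousLinearEquiv.ofBijective q hinj hsurj
  refine ⟨e.symm, ContinuousLinearMap.opNorm_le_bound _ (norm_nonneg _) fun ν => ?_,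
    ContinuousLinearMap.opNorm_le_bound _ zero_le_one fun w => ?_⟩
  · have h := hq (e.symm ν)
    have h' : q (e.symm ν) = ν := e.apply_symm_apply ν
    rwa [h'] at h
  · exact (freeQuot G o).le_of_opNorm_le norm_freeQuot_le w.1

end FixedProjection

/-! ## Invariance of the mean -/

section MeanInvariance

variable {G : Type*} [Group G] [TopologicalSpace G] [IsTopologicalGroup G]
  [MeasurableSpace G] [BorelSpace G]

/-- Right translations preserve null sets for Haar measure. -/
theorem quasiMeasurePreserving_mul_right_haar [LocallyCompactSpace G] (g : G) :
    Measure.QuasiMeasurePreserving (fun h : G => h * g)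
      (Measure.haar : Measure G) (Measure.haar : Measure G) := by
  refine ⟨measurable_mul_const g, ?_⟩
  have : (Measure.map (fun h : G => h * g) (Measure.haar : Measure G)).Regular :=
    Measure.Regular.map (Homeomorph.mulRight g)
  -- The right translate of Haar measure is regular and still left invariant, so by uniqueness it is
  -- a scalar multiple of Haar measure.
  rw [Measure.isMulLeftInvariant_eq_smul_of_regular
    (Measure.map (fun h : G => h * g) (Measure.haar : Measure G)) Measure.haar]
  exact Measure.smul_absolutelyContinuous

/-- On L_∞(G) the mean sees only classes of functions; the pointwise identity passes to
representatives because translation preserves null sets. -/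
theorem BiInvariantMean.eval_mul_left (m : BiInvariantMean G) (g : G) {f f' : Cbru G}
    (h : ∀ x, f'.1 x = f.1 (g * x)) : m.eval f' = m.eval f := by
  cases m with
  | ofLocallyCompact inst m =>
    -- The shift by g evaluates at g⁻¹h, so translating the argument by g is the shift by g⁻¹.
    refine m.left_inv g⁻¹ _ _ ?_
    have hf := (measurePreserving_mul_left (Measure.haar : Measure G)
      g).quasiMeasurePreserving.ae (Cbru.memLp f.2).coeFn_toLp
    filter_upwards [(Cbru.memLp f'.2).coeFn_toLp, hf] with x hx' hx
    rw [inv_inv]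
    exact hx'.trans ((h x).trans hx.symm)
  | ofSIN hG m =>
    refine m.left_inv g⁻¹ _ _ (lp.ext (funext fun x => ?_))
    rw [LInf.leftShift_apply, inv_inv]
    exact h x

theorem BiInvariantMean.eval_mul_right (m : BiInvariantMean G) (g : G) {f f' : Cbru G}
    (h : ∀ x, f'.1 x = f.1 (x * g)) : m.eval f' = m.eval f := by
  cases m with
  | ofLocallyCompact inst m =>
    refine m.right_inv g⁻¹ _ _ ?_
    have hf := (quasiMeasurePreserving_mul_right_haar g).ae (Cbru.memLp f.2).coeFn_toLp
    filter_upwards [(Cbru.memLp f'.2).coeFn_toLp, hf] with x hx' hx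
    rw [inv_inv]
    exact hx'.trans ((h x).trans hx.symm)
  | ofSIN hG m =>
    refine m.right_inv g⁻¹ _ _ (lp.ext (funext fun x => ?_))
    rw [LInf.rightShift_apply, inv_inv]
    exact h x

theorem BiInvariantMean.eval_const (m : BiInvariantMean G) {f : Cbru G} {c : ℝ}
    (h : ∀ x, f.1 x = c) : m.eval f = c := by
  let u : Cbru G := ⟨LInf.mk' (fun _ => 1) 1 (by simp), mem_Cbru_of_forall fun ε hε =>
    ⟨Set.univ, Filter.univ_mem, fun h _ g => by
      change |(1 : ℝ) - 1| ≤ ε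
      simpa using hε.le⟩⟩
  have hfu : f = c • u := Subtype.ext (lp.ext (funext fun x =>
    (h x).trans (mul_one c).symm))
  rw [hfu, map_smul, m.eval_one u fun _ => rfl, smul_eq_mul, mul_one]

end MeanInvariance

/-! ## Invariance of `R_G` and `P_G` -/

section OperatorInvariance

variable {G M : Type*} [Group G] [TopologicalSpace G] [IsTopologicalGroup G]
  [MetricSpace M] [MulAction G M] [IsIsometricSMul G M] [ContinuousSMul G M]
  [MeasurableSpace G] [BorelSpace G] {o : M} (m : BiInvariantMean G)

/-- Since T_h T_g = T_{hg}, replacing μ by T_g μ right-translates the function h ↦ φ(T_h μ). -/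
theorem opR_freeT (g : G) (μ : LipFree M o) : opR m o (freeT o g μ) = opR m o μ :=
  ContinuousLinearMap.ext fun φ => m.eval_mul_right g fun h =>
    congrArg φ (freeT_mul h g μ).symm

/-- Since T_g T_h = T_{gh}, replacing φ by φ ∘ T_g left-translates the function h ↦ φ(T_h μ). -/
theorem bidualMap_freeT_opR (g : G) (μ : LipFree M o) :
    bidualMap (freeT o g) (opR m o μ) = opR m o μ :=
  ContinuousLinearMap.ext fun φ => m.eval_mul_left g fun h =>
    congrArg φ (freeT_mul g h μ).symm

theorem opR_of_fixed {μ : LipFree M o} (h : ∀ g : G, freeT o g μ = μ) :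
    opR m o μ = NormedSpace.inclusionInDoubleDual ℝ (LipFree M o) μ :=
  ContinuousLinearMap.ext fun φ => m.eval_const fun g => congrArg φ (h g)

theorem norm_opR_le : ‖opR m o‖ ≤ 1 :=
  ContinuousLinearMap.opNorm_le_bound _ zero_le_one fun μ => by
    rw [one_mul]
    exact ContinuousLinearMap.opNorm_le_bound _ (norm_nonneg _) fun φ =>
      m.abs_eval_le (orbitFun G μ φ) (abs_apply_freeT_le μ φ)

variable {Q : StrongDual ℝ (StrongDual ℝ (LipFree M o)) →L[ℝ] LipFree M o}

theorem opP_freeT (g : G) (μ : LipFree M o) : opP m o Q (freeT o g μ) = opP m o Q μ :=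
  congrArg Q (opR_freeT m g μ)

theorem norm_opP_le : ‖opP m o Q‖ ≤ ‖Q‖ :=
  (Q.opNorm_comp_le _).trans
    ((mul_le_mul_of_nonneg_left (norm_opR_le m) (norm_nonneg _)).trans_eq (mul_one _))

/-- Write ι for the canonical embedding. The vector R_G μ - ι(Pμ) lies in ker Q; T_g** keeps it
there and turns it into R_G μ - ι(T_g Pμ). Applying Q gives Pμ = T_g Pμ. -/
theorem freeT_opP
    (hQ : ∀ x : LipFree M o, Q (NormedSpace.inclusionInDoubleDual ℝ (LipFree M o) x) = x)
    (hQker : ∀ (g : G) (z : StrongDual ℝ (StrongDual ℝ (LipFree M o))),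
      Q z = 0 → Q (bidualMap (freeT o g) z) = 0)
    (g : G) (μ : LipFree M o) :
    freeT o g (opP m o Q μ) = opP m o Q μ := by
  have h := hQker g (opR m o μ -
    NormedSpace.inclusionInDoubleDual ℝ (LipFree M o) (opP m o Q μ)) (by
      rw [map_sub, hQ]
      exact sub_self _)
  have h1 : bidualMap (freeT o g) (opR m o μ -
      NormedSpace.inclusionInDoubleDual ℝ (LipFree M o) (opP m o Q μ)) =
      opR m o μ - NormedSpace.inclusionInDoubleDual ℝ (LipFree M o)
        (freeT o g (opP m o Q μ)) := by
    -- Once R_G μ is written as T_g** R_G μ, the rest is linearity and T_g** ι = ι T_g, both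
    -- definitional.
    conv_rhs => rw [← bidualMap_freeT_opR m g μ]
    rfl
  rw [h1, map_sub, hQ, sub_eq_zero] at h
  exact h.symm

/-- Pμ is fixed by the action, so R_G embeds it canonically and Q returns it. -/
theorem opP_opP
    (hQ : ∀ x : LipFree M o, Q (NormedSpace.inclusionInDoubleDual ℝ (LipFree M o) x) = x)
    (hQker : ∀ (g : G) (z : StrongDual ℝ (StrongDual ℝ (LipFree M o))),
      Q z = 0 → Q (bidualMap (freeT o g) z) = 0)
    (μ : LipFree M o) : opP m o Q (opP m o Q μ) = opP m o Q μ := by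
  have h := opR_of_fixed m fun g => freeT_opP m hQ hQker g μ
  exact (congrArg Q h).trans (hQ _)

end OperatorInvariance

theorem mainTheorem7 {G M : Type*}
    [Group G] [TopologicalSpace G] [IsTopologicalGroup G] [T2Space G]
    [MeasurableSpace G] [BorelSpace G]
    [MetricSpace M] [MulAction G M] [IsIsometricSMul G M] [ContinuousSMul G M] (o : M)
    (hbdd : ∀ x : M, Bornology.IsBounded (MulAction.orbit G x))
    (hamen : IsAmenable G)
    (m : BiInvariantMean G)
    -- the projection of the bidual onto `F(M)`, viewed as a map with values in `F(M)`
    (Q : StrongDual ℝ (StrongDual ℝ (LipFree M o)) →L[ℝ] LipFree M o)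
    (hQ : ∀ x : LipFree M o, Q (NormedSpace.inclusionInDoubleDual ℝ (LipFree M o) x) = x)
    (hQker : ∀ (g : G) (z : StrongDual ℝ (StrongDual ℝ (LipFree M o))),
      Q z = 0 → Q (bidualMap (freeT o g) z) = 0)
    (Y : Set (Lip0 (OrbitSpace G M) (OrbitSpace.mk G o)))
    (hYsep : ∀ μ ν : LipFree (OrbitSpace G M) (OrbitSpace.mk G o),
      μ ≠ ν → ∃ f ∈ Y, μ.1 f ≠ ν.1 f)
    (hker : (opP m o Q).ker ≤ preannihilator ((fun f => (Psi G o f : Lip0 M o)) '' Y)) :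
    (opP m o Q).ker = preannihilator (lip0Inv G o : Set (Lip0 M o)) ∧
    (∃ T : LipFree (OrbitSpace G M) (OrbitSpace.mk G o) ≃L[ℝ] (opP m o Q).range,
      ‖(T : LipFree (OrbitSpace G M) (OrbitSpace.mk G o) →L[ℝ] (opP m o Q).range)‖ *
        ‖(T.symm : (opP m o Q).range →L[ℝ] LipFree (OrbitSpace G M) (OrbitSpace.mk G o))‖
          ≤ ‖Q‖) ∧
    (opP m o Q).range.ClosedComplemented := by
  have hPT := opP_freeT (o := o) (Q := Q) m
  have hPP := opP_opP m hQ hQker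
  have hker_quot : ∀ μ, opP m o Q μ = 0 → freeQuot G o μ = 0 := by
    intro μ hμ
    by_contra hne
    -- A nonzero qμ would be separated from 0 by some f in Y, yet ⟨f, qμ⟩ = ⟨Ψ(f), μ⟩ = 0.
    obtain ⟨f, hf, hne'⟩ := hYsep _ _ hne
    exact hne' (hker hμ _ ⟨f, hf, rfl⟩)
  refine ⟨le_antisymm (fun μ hμ => (freeQuot_eq_zero_iff μ).1 (hker_quot μ hμ))
    fun μ hμ => ?_, ?_, ?_⟩
  · have h := norm_apply_le_norm_freeQuot (hbdd o) hPT μ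
    rw [(freeQuot_eq_zero_iff μ).2 hμ, norm_zero, mul_zero] at h
    exact norm_le_zero_iff.1 h
  · obtain ⟨T, hT, hT'⟩ := exists_equiv_range (hbdd o) hPT hPP hker_quot
    exact ⟨T, ((mul_le_mul hT hT' (norm_nonneg _) (norm_nonneg _)).trans_eq
      (mul_one _)).trans (norm_opP_le m)⟩
  -- The idempotent P_G is itself the complementing projection.
  · refine ⟨(opP m o Q).codRestrict (opP m o Q).range fun μ => ⟨μ, rfl⟩, ?_⟩
    rintro ⟨_, μ, rfl⟩
    exact Subtype.ext (hPP μ)
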